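/- Let $\mathbb{K}$ be an algebraically closed field of characteristic zero, and let $\mathcal{A}=\mathbb{K}[X_1,\ldots,X_6]$ be the polynomial algebra with the Poisson bracket (the semiclassical limit of $U_q^+(G_2)$) determined on the generators by $$\begin{aligned} \{X_2,X_1\}&=-3X_1X_2, & \{X_3,X_1\}&=-X_1X_3-X_2, & \{X_3,X_2\}&=-3X_2X_3,\\ \{X_4,X_1\}&=-2X_3^2, & \{X_4,X_2\}&=-3X_2X_4-4X_3^3, & \{X_4,X_3\}&=-3X_3X_4,\\ \{X_5,X_1\}&=X_1X_5-2X_3, & \{X_5,X_2\}&=-6X_3^2, & \{X_5,X_3\}&=-X_3X_5-3X_4,\\ \{X_5,X_4\}&=-3X_4X_5, & \{X_6,X_1\}&=3X_1X_6-3X_5, & \{X_6,X_2\}&=3X_2X_6+9X_4-18X_3X_5,\\ \{X_6,X_3\}&=-6X_5^2, & \{X_6,X_4\}&=-3X_4X_6-4X_5^3, & \{X_6,X_5\}&=-3X_5X_6. \end{aligned}$$ A Poisson ideal of $\mathcal{A}$ is an ideal $I$ with $\{\mathcal{A},I\}\subseteq I$. A Poisson prime ideal is a proper Poisson ideal $P$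 such that, whenever $I_1,I_2$ are Poisson ideals with $I_1I_2\subseteq P$, one has $I_1\subseteq P$ or $I_2\subseteq P$. The torus $\mathcal{H}=(\mathbb{K}^*)^2$ acts on $\mathcal{A}$ by Poisson automorphisms: $h=(\alpha_1,\alpha_6)$ multiplies $X_1,\ldots,X_6$ by $\alpha_1,\ \alpha_1^3\alpha_6,\ \alpha_1^2\alpha_6,\ \alpha_1^3\alpha_6^2,\ \alpha_1\alpha_6,\ \alpha_6$ respectively. The $\langle 0\rangle$-stratum $\mathrm{P.Spec}_{\langle 0\rangle}(\mathcal{A})$ is the set of Poisson prime ideals $P$ of $\mathcal{A}$ with $\bigcap_{h\in\mathcal{H}}h\cdot P=\langle 0\rangle$. Put $$\Omega_1=X_1X_3X_5-\tfrac32X_1X_4-\tfrac12X_2X_5+\tfrac12X_3^2,$$ $$\Omega_2=X_2X_4X_6-\tfrac23X_3^3X_6-\tfrac23X_2X_5^3+2X_3^2X_5^2-3X_3X_4X_5+\tfrac32X_4^2.$$ Fix a monomial order on polynomials in two variables $Y_1,Y_2$, and let $\mathcal{P}$ be the set of irreducible polynomials $P(Y_1,Y_2)\in\mathbb{K}[Y_1,Y_2]$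 that are monic (leading coefficient $1$ for this order) and different from $Y_1$ and $Y_2$. Then $$\mathrm{P.Spec}_{\langle 0\rangle}(\mathcal{A})=\{\langle 0\rangle\}\cup\{\langle P(\Omega_1,\Omega_2)\rangle\mid P\in\mathcal{P}\}\cup\{\langle\Omega_1-\alpha,\Omega_2-\beta\rangle\mid\alpha,\beta\in\mathbb{K}^*\}.$$ -/

import Mathlib

/-- A Poisson bracket on a commutative `K`-algebra `A`: a skew-symmetric `K`-bilinear map
satisfying the Leibniz rule and the Jacobi identity. -/
structure PoissonBracket (K A : Type*) [Field K] [CommRing A] [Algebra K A] where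
  /-- the underlying bilinear map -/
  br : A →ₗ[K] A →ₗ[K] A
  skew : ∀ x y, br x y = -br y x
  leibniz : ∀ x y z, br x (y * z) = br x y * z + y * br x z
  jacobi : ∀ x y z, br x (br y z) + br y (br z x) + br z (br x y) = 0

namespace PoissonBracket

section General

variable {K A : Type*} [Field K] [CommRing A] [Algebra K A]

/-- `I` is a Poisson ideal: `{A, I} ⊆ I`. -/
def IsPoissonIdeal (B : PoissonBracket K A) (I : Ideal A) : Prop :=
  ∀ a : A, ∀ x ∈ I, B.br a x ∈ I

/-- `P` is a Poisson prime ideal: a proper Poisson ideal such that, for all Poisson ideals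
`I₁, I₂` with `I₁ I₂ ⊆ P`, one has `I₁ ⊆ P` or `I₂ ⊆ P`. -/
def IsPoissonPrime (B : PoissonBracket K A) (P : Ideal A) : Prop :=
  B.IsPoissonIdeal P ∧ P ≠ ⊤ ∧
    ∀ I₁ I₂ : Ideal A, B.IsPoissonIdeal I₁ → B.IsPoissonIdeal I₂ →
      I₁ * I₂ ≤ P → I₁ ≤ P ∨ I₂ ≤ P

/-- The Poisson prime spectrum. -/
def poissonSpec (B : PoissonBracket K A) : Set (Ideal A) :=
  {P | B.IsPoissonPrime P}

/-- For a family of algebra automorphisms `act h` of `A` indexed by `h : H`, the `J`-stratum of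
the Poisson prime spectrum: all Poisson primes `P` with `⋂ h, h • P = J`. -/
def stratum {H : Type*} (B : PoissonBracket K A) (act : H → (A ≃ₐ[K] A)) (J : Ideal A) :
    Set (Ideal A) :=
  {P | P ∈ B.poissonSpec ∧ ⨅ h : H, P.map (act h) = J}

end General

end PoissonBracket

namespace PoissonG2

open MvPolynomial

section Algebra

variable (K : Type*) [Field K]

/-- The polynomial algebra `𝒜 = K[X₁, …, X₆]`; the variable `Xᵢ` is `X (i - 1)`. -/
abbrev A : Type _ := MvPolynomial (Fin 6) K

/-- The Poisson brackets `{Xᵢ, Xⱼ}` for `j < i` (row `i`, column `j`), zeros elsewhere. -/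
noncomputable def lowerBracket : Matrix (Fin 6) (Fin 6) (A K) :=
  let X₁ : A K := X 0
  let X₂ : A K := X 1
  let X₃ : A K := X 2
  let X₄ : A K := X 3
  let X₅ : A K := X 4
  let X₆ : A K := X 5
  !![0, 0, 0, 0, 0, 0;
     -3 * X₁ * X₂, 0, 0, 0, 0, 0;
     -X₁ * X₃ - X₂, -3 * X₂ * X₃, 0, 0, 0, 0;
     -2 * X₃ ^ 2, -3 * X₂ * X₄ - 4 * X₃ ^ 3, -3 * X₃ * X₄, 0, 0, 0;
     X₁ * X₅ - 2 * X₃, -6 * X₃ ^ 2, -X₃ * X₅ - 3 * X₄, -3 * X₄ * X₅, 0, 0;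
     3 * X₁ * X₆ - 3 * X₅, 3 * X₂ * X₆ + 9 * X₄ - 18 * X₃ * X₅, -6 * X₅ ^ 2,
       -3 * X₄ * X₆ - 4 * X₅ ^ 3, -3 * X₅ * X₆, 0]

/-- The skew-symmetric matrix of all brackets `{Xᵢ, Xⱼ}` of the generators. -/
noncomputable def genBracket (i j : Fin 6) : A K :=
  lowerBracket K i j - lowerBracket K j i

/-- `{f, g} = ∑ᵢⱼ {Xᵢ, Xⱼ} (∂f/∂Xᵢ) (∂g/∂Xⱼ)`. -/
noncomputable def bracketMap : A K →ₗ[K] A K →ₗ[K] A K :=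
  LinearMap.mk₂ K (fun f g => ∑ i, ∑ j, genBracket K i j * pderiv i f * pderiv j g)
    (fun f f' g => by
      simp only [map_add, ← Finset.sum_add_distrib]
      exact Finset.sum_congr rfl fun i _ => Finset.sum_congr rfl fun j _ => by ring)
    (fun c f g => by
      simp only [Derivation.map_smul, Finset.smul_sum]
      exact Finset.sum_congr rfl fun i _ => Finset.sum_congr rfl fun j _ => by
        simp only [smul_eq_C_mul]; ring)
    (fun f g g' => by
      simp only [map_add, ← Finset.sum_add_distrib]
      exact Finset.sum_congr rfl fun i _ => Finset.sum_congr rfl fun j _ => by ring)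
    (fun c f g => by
      simp only [Derivation.map_smul, Finset.smul_sum]
      exact Finset.sum_congr rfl fun i _ => Finset.sum_congr rfl fun j _ => by
        simp only [smul_eq_C_mul]; ring)

theorem bracketMap_apply (f g : A K) :
    bracketMap K f g = ∑ i, ∑ j, genBracket K i j * pderiv i f * pderiv j g := rfl

theorem bracketMap_skew (f g : A K) : bracketMap K f g = -bracketMap K g f := by
  rw [bracketMap_apply, bracketMap_apply, Finset.sum_comm, ← Finset.sum_neg_distrib]
  refine Finset.sum_congr rfl fun i _ => ?_
  rw [← Finset.sum_neg_distrib]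
  refine Finset.sum_congr rfl fun j _ => ?_
  simp only [genBracket]
  ring

theorem bracketMap_leibniz (f g h : A K) :
    bracketMap K f (g * h) = bracketMap K f g * h + g * bracketMap K f h := by
  simp only [bracketMap_apply, Finset.sum_mul, Finset.mul_sum, ← Finset.sum_add_distrib]
  refine Finset.sum_congr rfl fun i _ => Finset.sum_congr rfl fun j _ => ?_
  simp only [Derivation.leibniz, smul_eq_mul]
  ring

theorem bracketMap_C (f : A K) (c : K) : bracketMap K f (C c) = 0 := by
  simp [bracketMap_apply]

theorem bracketMap_X_left (i : Fin 6) (g : A K) :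
    bracketMap K (X i) g = ∑ j, genBracket K i j * pderiv j g := by
  rw [bracketMap_apply, Finset.sum_eq_single i]
  · simp
  · intro k _ hk
    simp [pderiv_X_of_ne hk.symm]
  · simp

theorem bracketMap_X_X (i j : Fin 6) : bracketMap K (X i) (X j) = genBracket K i j := by
  rw [bracketMap_X_left, Finset.sum_eq_single j]
  · simp
  · intro k _ hk
    simp [pderiv_X_of_ne hk.symm]
  · simp

/-- The cyclic sum in the Jacobi identity. -/
noncomputable def jac (f g h : A K) : A K :=
  bracketMap K f (bracketMap K g h) + bracketMap K g (bracketMap K h f) +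
    bracketMap K h (bracketMap K f g)

theorem jac_cyc (f g h : A K) : jac K f g h = jac K g h f := by
  simp only [jac]; ring

theorem jac_swap (f g h : A K) : jac K f g h = -jac K g f h := by
  simp only [jac]
  rw [bracketMap_skew K h g, bracketMap_skew K h f, bracketMap_skew K g f]
  simp only [map_neg]
  ring

theorem jac_eq_zero_of_X (f g : A K) (H : ∀ k, jac K f g (X k) = 0) (h : A K) :
    jac K f g h = 0 := by
  induction h using MvPolynomial.induction_on with
  | C c =>
    simp only [jac]
    rw [bracketMap_skew K (C c) f, bracketMap_skew K (C c) (bracketMap K f g)]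
    simp [bracketMap_C]
  | add p q hp hq =>
    have e : jac K f g (p + q) = jac K f g p + jac K f g q := by
      simp only [jac, map_add, LinearMap.add_apply]; ring
    rw [e, hp, hq, add_zero]
  | mul_X p k hp =>
    have e : jac K f g (p * X k) = jac K f g p * X k + p * jac K f g (X k) := by
      simp only [jac]
      rw [bracketMap_skew K (p * X k) f, bracketMap_skew K (p * X k) (bracketMap K f g),
        bracketMap_skew K p f, bracketMap_skew K p (bracketMap K f g),
        bracketMap_skew K (X k) f, bracketMap_skew K (X k) (bracketMap K f g)]
      simp only [bracketMap_leibniz, map_add, map_neg]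
      ring
    rw [e, hp, H k]; simp

theorem bracketMap_natCast (f : A K) (n : ℕ) : bracketMap K f (n : A K) = 0 := by
  rw [← map_natCast (C : K →+* A K) n]
  exact bracketMap_C K f _

set_option maxHeartbeats 2000000 in
theorem jac_XXX_of_lt (i j k : Fin 6) (hij : i < j) (hjk : j < k) :
    jac K (X i) (X j) (X k) = 0 := by
  have h2 : ∀ f, bracketMap K f 2 = 0 := fun f => bracketMap_natCast K f 2
  have h3 : ∀ f, bracketMap K f 3 = 0 := fun f => bracketMap_natCast K f 3
  have h4 : ∀ f, bracketMap K f 4 = 0 := fun f => bracketMap_natCast K f 4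
  have h6 : ∀ f, bracketMap K f 6 = 0 := fun f => bracketMap_natCast K f 6
  have h9 : ∀ f, bracketMap K f 9 = 0 := fun f => bracketMap_natCast K f 9
  have h18 : ∀ f, bracketMap K f 18 = 0 := fun f => bracketMap_natCast K f 18
  fin_cases i <;> fin_cases j <;> first | (exact absurd hij (by decide)) | skip
  all_goals fin_cases k <;> first | (exact absurd hjk (by decide)) | skip
  all_goals
    simp only [jac, bracketMap_X_X]
    simp [genBracket, lowerBracket, bracketMap_leibniz, h2, h3, h4, h6, h9, h18, pow_succ,
      bracketMap_X_X]
    try ring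

theorem jac_self (f h : A K) : jac K f f h = 0 := by
  have e : ∀ x : A K, bracketMap K x x = 0 := fun x => by
    have h0 : ∀ i j, genBracket K i j * pderiv i x * pderiv j x
        = lowerBracket K i j * pderiv i x * pderiv j x
          - lowerBracket K j i * pderiv j x * pderiv i x := fun i j => by
      simp only [genBracket]; ring
    simp only [bracketMap_apply, h0, Finset.sum_sub_distrib]
    rw [sub_eq_zero]
    exact Finset.sum_comm
  simp only [jac, e, map_zero]
  rw [bracketMap_skew K h f, map_neg]
  ring

theorem jac_XXX (i j k : Fin 6) : jac K (X i) (X j) (X k) = 0 := by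
  have key : ∀ a b c : Fin 6, a < b → jac K (X a) (X b) (X c) = 0 := by
    intro a b c hab
    rcases lt_trichotomy b c with h | h | h
    · exact jac_XXX_of_lt K a b c hab h
    · subst h
      rw [jac_cyc, jac_self]
    · rcases lt_trichotomy a c with h' | h' | h'
      · rw [jac_cyc, jac_cyc, jac_swap, jac_cyc, jac_cyc, jac_cyc,
          jac_XXX_of_lt K a c b h' h, neg_zero]
      · subst h'
        rw [jac_cyc, jac_cyc, jac_self]
      · rw [jac_cyc, jac_cyc, jac_XXX_of_lt K c a b h' hab]
  rcases lt_trichotomy i j with h | h | h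
  · exact key i j k h
  · subst h; exact jac_self K _ _
  · rw [jac_swap, key j i k h, neg_zero]

theorem bracketMap_jacobi (f g h : A K) :
    bracketMap K f (bracketMap K g h) + bracketMap K g (bracketMap K h f) +
      bracketMap K h (bracketMap K f g) = 0 := by
  change jac K f g h = 0
  refine jac_eq_zero_of_X K f g (fun k => ?_) h
  rw [jac_cyc, jac_cyc]
  refine jac_eq_zero_of_X K _ f (fun l => ?_) g
  rw [jac_cyc, jac_cyc]
  exact jac_eq_zero_of_X K _ _ (fun m => jac_XXX K l k m) f

/-- The Poisson algebra structure on `𝒜 = K[X₁, …, X₆]`. -/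
noncomputable def bracket : PoissonBracket K (A K) where
  br := bracketMap K
  skew := bracketMap_skew K
  leibniz := bracketMap_leibniz K
  jacobi := bracketMap_jacobi K

/-- The scalars by which `h = (α₁, α₆) ∈ (K*)²` multiplies `X₁, …, X₆`. -/
def weight (h : Kˣ × Kˣ) : Fin 6 → Kˣ :=
  ![h.1, h.1 ^ 3 * h.2, h.1 ^ 2 * h.2, h.1 ^ 3 * h.2 ^ 2, h.1 * h.2, h.2]

/-- The action of the torus `ℋ = (K*)²` on `𝒜`: the algebra automorphism
`Xᵢ ↦ weight h i • Xᵢ`. -/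
noncomputable def torusAct (h : Kˣ × Kˣ) : A K ≃ₐ[K] A K :=
  AlgEquiv.ofAlgHom
    (aeval fun i => C (weight K h i : K) * X i)
    (aeval fun i => C (((weight K h i)⁻¹ : Kˣ) : K) * X i)
    (by
      ext1 i
      simp only [AlgHom.comp_apply, aeval_X, map_mul, algHom_C, algebraMap_eq, AlgHom.id_apply]
      rw [← mul_assoc, ← C_mul, Units.inv_mul, C_1, one_mul])
    (by
      ext1 i
      simp only [AlgHom.comp_apply, aeval_X, map_mul, algHom_C, algebraMap_eq, AlgHom.id_apply]
      rw [← mul_assoc, ← C_mul, Units.mul_inv, C_1, one_mul])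

/-- `Ω₁ = X₁X₃X₅ - (3/2)X₁X₄ - (1/2)X₂X₅ + (1/2)X₃²`. -/
noncomputable def Ω₁ : A K :=
  let X₁ : A K := X 0
  let X₂ : A K := X 1
  let X₃ : A K := X 2
  let X₄ : A K := X 3
  let X₅ : A K := X 4
  X₁ * X₃ * X₅ - C (3 / 2) * X₁ * X₄ - C (1 / 2) * X₂ * X₅ + C (1 / 2) * X₃ ^ 2

/-- `Ω₂ = X₂X₄X₆ - (2/3)X₃³X₆ - (2/3)X₂X₅³ + 2X₃²X₅² - 3X₃X₄X₅ + (3/2)X₄²`. -/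
noncomputable def Ω₂ : A K :=
  let X₂ : A K := X 1
  let X₃ : A K := X 2
  let X₄ : A K := X 3
  let X₅ : A K := X 4
  let X₆ : A K := X 5
  X₂ * X₄ * X₆ - C (2 / 3) * X₃ ^ 3 * X₆ - C (2 / 3) * X₂ * X₅ ^ 3
    + 2 * X₃ ^ 2 * X₅ ^ 2 - 3 * X₃ * X₄ * X₅ + C (3 / 2) * X₄ ^ 2

/-- The element `P(Ω₁, Ω₂)` of `𝒜`, for a polynomial `P` in two variables. -/
noncomputable def atΩ (P : MvPolynomial (Fin 2) K) : A K :=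
  aeval ![Ω₁ K, Ω₂ K] P

/-- The monic irreducible polynomials in two variables other than the two variables; monic
means that the leading coefficient for the monomial order `m` is `1`. -/
def monicIrreducibles (m : MonomialOrder (Fin 2)) : Set (MvPolynomial (Fin 2) K) :=
  {P | m.Monic P ∧ Irreducible P ∧ P ≠ X 0 ∧ P ≠ X 1}

end Algebra

end PoissonG2

/-! The elements `y K i` log-commute with a nondegenerate exponent matrix, and Ω₁, Ω₂ are Casimirs.
Inverting the `y K i` turns 𝒜 into Laurent polynomials in them over K[Ω₁, Ω₂], because X₃, X₄, X₅,
X₆ can be solved for one after another. There the derivations {yᵢ, ·} separate monomials by weight,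
so a Poisson ideal is generated by its Casimirs (`evalΩ_coeff_mem`, `le_map_comap_evalΩ`).

A Poisson prime is prime in characteristic zero. In the zero stratum it contains no nonzero torus
eigenvector, hence none of the yᵢ, Ω₁, Ω₂. It is therefore extended from a prime of K[Y₁, Y₂]
avoiding Y₁ and Y₂, provided the extension has no yᵢ-torsion. Such a prime is zero, principal or the
ideal of a point.

Torsion-freeness (`YRegular`) returns from the localization to 𝒜. For a principal ideal, yᵢ is prime
and the hypersurface yᵢ = 0 maps onto (K*)² under (Ω₁, Ω₂). For a point of (K*)², brackets with yᵢ
force Ω₁ or Ω₂, hence a unit, into any radical Poisson ideal containing yᵢ and the given ideal.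

Conversely, torsion-free extensions of primes are prime (`isPrime_map_evalΩ`). They lie in the
stratum once the plane prime has a zero in (K*)², since the torus acts transitively on the nonzero
values of (Ω₁, Ω₂). -/

namespace PoissonBracket

/-! ### Poisson ideals and Poisson primes in characteristic zero -/

variable {K A : Type*} [Field K] [CommRing A] [Algebra K A] (B : PoissonBracket K A)

theorem br_mul_left (x y z : A) : B.br (x * y) z = B.br x z * y + x * B.br y z := by
  rw [B.skew (x * y) z, B.leibniz, B.skew z x, B.skew z y]
  ring

theorem br_one (x : A) : B.br x 1 = 0 := by
  have h := B.leibniz x 1 1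
  simpa using h

theorem br_pow (x y : A) (n : ℕ) : B.br x (y ^ n) = n * y ^ (n - 1) * B.br x y := by
  induction n with
  | zero => simp [B.br_one]
  | succ n ih =>
    rw [pow_succ, B.leibniz, ih]
    rcases n with _ | n
    · simp
    · simp only [Nat.add_sub_cancel]
      push_cast
      ring

theorem isPoissonIdeal_span_of_central {S : Set A} (hS : ∀ s ∈ S, ∀ a, B.br a s = 0) :
    B.IsPoissonIdeal (Ideal.span S) := by
  intro a x hx
  induction hx using Submodule.span_induction with
  | mem s hs => rw [hS s hs]; exact zero_mem _
  | zero => rw [map_zero]; exact zero_mem _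
  | add x y _ _ hx hy => rw [map_add]; exact add_mem hx hy
  | smul r x hx ih =>
    rw [smul_eq_mul, B.leibniz]
    exact add_mem (Ideal.mul_mem_left _ _ hx) (Ideal.mul_mem_left _ _ ih)

/-- A proper prime ideal which is Poisson is Poisson prime. -/
theorem isPoissonPrime_of_isPrime {P : Ideal A} (hP : B.IsPoissonIdeal P) (h : P.IsPrime) :
    B.IsPoissonPrime P :=
  ⟨hP, h.ne_top, fun _ _ _ _ h' => h.mul_le.mp h'⟩

theorem IsPoissonIdeal.colon {B : PoissonBracket K A} {Q T : Ideal A} (hQ : B.IsPoissonIdeal Q)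
    (hT : B.IsPoissonIdeal T) : B.IsPoissonIdeal (Q.colon (T : Set A)) := by
  intro b r hr
  rw [Submodule.mem_colon] at hr ⊢
  intro t ht
  have h1 := hQ b _ (hr t ht)
  rw [smul_eq_mul, B.leibniz] at h1
  have h2 := hr _ (hT b t ht)
  rw [smul_eq_mul] at h2 ⊢
  have := sub_mem h1 h2
  rwa [add_sub_cancel_right] at this

/-- Leibniz gives ({b,x}a)² = {b,x}a·{b,xa} − {b,x}{b,a}·xa, so only the square of {b,x}a is seen to
lie in P; hence the radicality hypothesis. -/
theorem IsPoissonIdeal.colon_singleton {B : PoissonBracket K A} {P : Ideal A}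
    (hP : B.IsPoissonIdeal P) (hrad : P.radical ≤ P) (a : A) :
    B.IsPoissonIdeal (P.colon {a}) := by
  intro b x hx
  rw [Submodule.mem_colon_singleton, smul_eq_mul] at hx ⊢
  apply hrad
  refine ⟨2, ?_⟩
  have h1 := hP b _ hx
  rw [B.leibniz] at h1
  have h2 := sub_mem (P.mul_mem_left (B.br b x * a) h1) (P.mul_mem_left (B.br b x * B.br b a) hx)
  convert h2 using 1
  ring

theorem natCast_mul_mem (K : Type*) [Field K] [CharZero K] [Algebra K A] {I : Ideal A} {n : ℕ} (hn : n ≠ 0) {x : A} (h : (n : A) * x ∈ I) :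
    x ∈ I := by
  have e : x = algebraMap K A ((n : K)⁻¹) * ((n : A) * x) := by
    rw [← mul_assoc, ← map_natCast (algebraMap K A) n, ← map_mul,
      inv_mul_cancel₀ (Nat.cast_ne_zero.mpr hn), map_one, one_mul]
  rw [e]
  exact Ideal.mul_mem_left _ _ h

section CharZero

variable [CharZero K]

/-- In characteristic zero the radical of a Poisson ideal is a Poisson ideal. -/
theorem IsPoissonIdeal.radical {B : PoissonBracket K A} {J : Ideal A} (hJ : B.IsPoissonIdeal J) :
    B.IsPoissonIdeal J.radical := by
  intro b a ⟨n, hn⟩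
  -- Each application of {b, ·}, followed by multiplication by {b,a}, trades one factor a for two
  -- factors {b,a}. The other Leibniz term is a multiple of the previous element, and the integer
  -- coefficient is invertible.
  have key : ∀ k ≤ n, a ^ (n - k) * B.br b a ^ (2 * k) ∈ J := by
    intro k
    induction k with
    | zero => intro _; simpa using hn
    | succ k ih =>
      intro hk
      have h1 := ih (by omega)
      obtain ⟨m, hm⟩ : ∃ m, n - k = m + 1 := ⟨n - k - 1, by omega⟩
      have hm' : n - (k + 1) = m := by omega
      rw [hm] at h1
      rw [hm']
      have h2 := hJ b _ h1
      rw [B.leibniz, B.br_pow, B.br_pow] at h2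
      have h3 : ((m + 1 : ℕ) : A) * (a ^ m * B.br b a ^ (2 * (k + 1))) ∈ J := by
        have h4 := J.mul_mem_right (B.br b a) h2
        rcases k with _ | k
        · simpa [mul_comm, mul_left_comm, mul_assoc, pow_two] using h4
        · have h5 := J.mul_mem_right ((2 * (k + 1) : ℕ) * B.br b (B.br b a)) h1
          have e : 2 * (k + 1) - 1 = 2 * k + 1 := by omega
          rw [e] at h4
          have h6 := sub_mem h4 h5
          convert h6 using 1
          simp only [Nat.add_sub_cancel]
          ring
      exact natCast_mul_mem K (Nat.succ_ne_zero m) h3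
  exact ⟨2 * n, by simpa using key n le_rfl⟩

/-- Some power of the radical lies in P by Noetherianity; all its powers are Poisson, so Poisson
primeness peels off one factor at a time. -/
theorem IsPoissonPrime.radical_le [IsNoetherianRing A] {B : PoissonBracket K A} {P : Ideal A}
    (hP : B.IsPoissonPrime P) : P.radical ≤ P := by
  obtain ⟨n, hn⟩ := P.exists_radical_pow_le_of_fg (IsNoetherian.noetherian _)
  have hpow : ∀ k, B.IsPoissonIdeal (P.radical ^ k) := by
    intro k
    induction k with
    | zero => intro _ _ _; simp
    | succ k ih =>
      intro b x hx
      rw [pow_succ] at hx ⊢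
      induction hx using Submodule.mul_induction_on' with
      | mem_mul_mem u hu v hv =>
        rw [B.leibniz]
        exact add_mem (Ideal.mul_mem_mul (ih b u hu) hv)
          (Ideal.mul_mem_mul hu (hP.1.radical b v hv))
      | add u _ v _ h1 h2 => rw [map_add]; exact add_mem h1 h2
  induction n with
  | zero =>
    rw [pow_zero, Ideal.one_eq_top, top_le_iff] at hn
    exact absurd hn hP.2.1
  | succ n ih =>
    rw [pow_succ] at hn
    exact (hP.2.2 _ _ (hpow n) hP.1.radical hn).elim ih id

/-- In a Noetherian Poisson algebra over a field of characteristic zero, Poisson prime ideals are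
prime. -/
theorem IsPoissonPrime.isPrime [IsNoetherianRing A] {B : PoissonBracket K A} {P : Ideal A}
    (hP : B.IsPoissonPrime P) : P.IsPrime := by
  refine ⟨hP.2.1, fun {a b} hab => ?_⟩
  -- Both (P : a) and (P : (P : a)) are Poisson and their product lies in P. The first contains b
  -- and the second contains a.
  have h1 := hP.1.colon_singleton hP.radical_le a
  have h2 := hP.1.colon h1
  have h3 := hP.2.2 _ _ h1 h2 (by
    rw [Ideal.mul_le]
    intro r hr s hs
    rw [mul_comm]
    exact Submodule.mem_colon.mp hs r hr)
  rcases h3 with h | h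
  · right
    apply h
    rw [Submodule.mem_colon_singleton, smul_eq_mul, mul_comm]
    exact hab
  · left
    apply h
    rw [Submodule.mem_colon]
    intro x hx
    have := Submodule.mem_colon_singleton.mp hx
    rw [smul_eq_mul] at this ⊢
    rwa [mul_comm]

/-- If no proper radical Poisson ideal contains a Poisson ideal `Q` together with `y`, then `y`
is a non-zero-divisor modulo `Q`. -/
theorem IsPoissonIdeal.mem_of_mul_mem [IsNoetherianRing A] {B : PoissonBracket K A} {Q : Ideal A}
    (hQ : B.IsPoissonIdeal Q) {y : A}
    (hy : ∀ J : Ideal A, B.IsPoissonIdeal J → J.IsRadical → Q ≤ J → y ∈ J → J = ⊤)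
    {a : A} (ha : y * a ∈ Q) : a ∈ Q := by
  -- T consists of the elements killed modulo Q by a power of y. It is Poisson and finitely
  -- generated, so one power yⁿ works for all of T; then y lies in the radical of (Q : T), which
  -- forces 1 ∈ (Q : T).
  let T : Ideal A :=
    { carrier := {a | ∃ n : ℕ, y ^ n * a ∈ Q}
      zero_mem' := ⟨0, by simp⟩
      add_mem' := by
        rintro u v ⟨n, hn⟩ ⟨m, hm⟩
        refine ⟨n + m, ?_⟩
        have := add_mem (Q.mul_mem_left (y ^ m) hn) (Q.mul_mem_left (y ^ n) hm)
        convert this using 1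
        ring
      smul_mem' := by
        rintro c u ⟨n, hn⟩
        refine ⟨n, ?_⟩
        have := Q.mul_mem_left c hn
        convert this using 1
        rw [smul_eq_mul]
        ring }
  have hT : B.IsPoissonIdeal T := by
    rintro b u ⟨n, hn⟩
    refine ⟨n + 1, ?_⟩
    have h1 := hQ b _ hn
    rw [B.leibniz, B.br_pow] at h1
    have h2 := sub_mem (Q.mul_mem_left y h1)
      (Q.mul_mem_left (n * B.br b y) hn)
    convert h2 using 1
    rcases n with _ | n
    · simp
    · simp only [Nat.add_sub_cancel]
      ring
  obtain ⟨n, hn⟩ : ∃ n : ℕ, ∀ t ∈ T, y ^ n * t ∈ Q := by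
    obtain ⟨S, hS⟩ := IsNoetherian.noetherian T
    have hmem : ∀ s ∈ S, ∃ n : ℕ, y ^ n * s ∈ Q := fun s hs => by
      have : s ∈ T := hS ▸ Submodule.subset_span hs
      exact this
    choose! f hf using hmem
    refine ⟨S.sup f, fun t ht => ?_⟩
    rw [← hS] at ht
    induction ht using Submodule.span_induction with
    | mem s hs =>
      rw [← Nat.sub_add_cancel (Finset.le_sup (f := f) hs), pow_add, mul_assoc]
      exact Q.mul_mem_left _ (hf s hs)
    | zero => simp
    | add u v _ _ hu hv => rw [mul_add]; exact add_mem hu hv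
    | smul r u _ hu =>
      rw [smul_eq_mul, mul_left_comm]
      exact Q.mul_mem_left _ hu
  have hJ := hy (Q.colon (T : Set A)).radical (hQ.colon hT).radical (Ideal.radical_isRadical _)
    (le_trans (fun x hx => Submodule.mem_colon.mpr fun t _ => Q.mul_mem_right _ hx)
      Ideal.le_radical)
    ⟨n, Submodule.mem_colon.mpr hn⟩
  rw [Ideal.radical_eq_top, Ideal.eq_top_iff_one, Submodule.mem_colon] at hJ
  have := hJ a ⟨1, by simpa using ha⟩
  rwa [one_smul] at this

end CharZero

end PoissonBracket

namespace PoissonG2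

open MvPolynomial

/-! ### Log-canonical elements and Casimirs -/

section LogCanonical

variable (K : Type*) [Field K]

theorem bracketMap_eq_sum_X (f g : A K) :
    bracketMap K f g = ∑ i, pderiv i f * bracketMap K (X i) g := by
  rw [bracketMap_apply]
  refine Finset.sum_congr rfl fun i _ => ?_
  rw [bracketMap_X_left, Finset.mul_sum]
  exact Finset.sum_congr rfl fun j _ => by ring

theorem bracketMap_eq_zero_of_X {g : A K} (h : ∀ i, bracketMap K (X i) g = 0) (f : A K) :
    bracketMap K f g = 0 := by
  rw [bracketMap_eq_sum_X]
  exact Finset.sum_eq_zero fun i _ => by rw [h i, mul_zero]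

/-- The pairwise log-canonical elements `X₁`, `X₂`, `X₁X₃ - X₂/2` and `X₂X₄ - (2/3)X₃³`. -/
noncomputable def y : Fin 4 → A K :=
  ![X 0, X 1, X 0 * X 2 - C (1 / 2) * X 1, X 1 * X 3 - C (2 / 3) * X 2 ^ 3]

/-- The exponents in `{yᵢ, yⱼ} = λᵢⱼ yᵢ yⱼ`. -/
def lam : Matrix (Fin 4) (Fin 4) ℤ :=
  !![0, 3, 1, 3; -3, 0, 0, 3; -1, 0, 0, 3; -3, -3, -3, 0]

theorem bracketMap_mul_left (f g h : A K) :
    bracketMap K (f * g) h = bracketMap K f h * g + f * bracketMap K g h :=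
  (bracket K).br_mul_left f g h

theorem bracketMap_ofNat (f : A K) (n : ℕ) [n.AtLeastTwo] :
    bracketMap K f ofNat(n) = 0 :=
  bracketMap_natCast K f n

theorem bracketMap_ofNat_left (f : A K) (n : ℕ) [n.AtLeastTwo] :
    bracketMap K ofNat(n) f = 0 := by
  rw [bracketMap_skew, bracketMap_ofNat, neg_zero]

theorem bracketMap_ofNat_mul (n : ℕ) [n.AtLeastTwo] (f g : A K) :
    bracketMap K f (ofNat(n) * g) = ofNat(n) * bracketMap K f g := by
  rw [bracketMap_leibniz, bracketMap_ofNat, zero_mul, zero_add]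

theorem bracketMap_ofNat_mul_left (n : ℕ) [n.AtLeastTwo] (f g : A K) :
    bracketMap K (ofNat(n) * f) g = ofNat(n) * bracketMap K f g := by
  rw [bracketMap_mul_left, bracketMap_ofNat_left, zero_mul, zero_add]

theorem bracketMap_self (f : A K) : bracketMap K f f = 0 := by
  simp only [bracketMap_apply, genBracket, sub_mul, Finset.sum_sub_distrib]
  rw [sub_eq_zero, Finset.sum_comm]
  exact Finset.sum_congr rfl fun _ _ => Finset.sum_congr rfl fun _ _ => by ring

theorem C_mul_ofNat {a : K} {m n : ℕ} [m.AtLeastTwo] [n.AtLeastTwo]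
    (h : (ofNat(m) : K) * a = ofNat(n)) : (ofNat(m) : A K) * C a = ofNat(n) := by
  rw [← map_ofNat (C : K →+* A K) m, ← C_mul, h, map_ofNat]

variable [CharZero K]

theorem two_mul_C_half : (2 : A K) * C (1 / 2) = 1 := by
  rw [← map_ofNat (C : K →+* A K) 2, ← C_mul]
  norm_num

/-- Clearing denominators leaves integer coefficients, so the bracket computations need no constants
`C (1 / 2)`. -/
theorem two_mul_Ω₁ : 2 * Ω₁ K =
    2 * X 0 * X 2 * X 4 - 3 * X 0 * X 3 - X 1 * X 4 + X 2 ^ 2 := by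
  have h2 := two_mul_C_half K
  have h3 : (2 : A K) * C (3 / 2) = 3 := C_mul_ofNat K (by norm_num)
  simp only [Ω₁]
  linear_combination (X 2 ^ 2 - X 1 * X 4) * h2 - X 0 * X 3 * h3

theorem six_mul_Ω₂ : 6 * Ω₂ K =
    6 * X 1 * X 3 * X 5 - 4 * X 2 ^ 3 * X 5 - 4 * X 1 * X 4 ^ 3 + 12 * X 2 ^ 2 * X 4 ^ 2
      - 18 * X 2 * X 3 * X 4 + 9 * X 3 ^ 2 := by
  have h2 : (6 : A K) * C (2 / 3) = 4 := C_mul_ofNat K (by norm_num)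
  have h3 : (6 : A K) * C (3 / 2) = 9 := C_mul_ofNat K (by norm_num)
  simp only [Ω₂]
  linear_combination (-X 2 ^ 3 * X 5 - X 1 * X 4 ^ 3) * h2 + X 3 ^ 2 * h3

theorem two_mul_y_two : 2 * y K 2 = 2 * X 0 * X 2 - X 1 := by
  have h2 := two_mul_C_half K
  simp only [y, Matrix.cons_val]
  linear_combination - X 1 * h2

theorem three_mul_y_three : 3 * y K 3 = 3 * X 1 * X 3 - 2 * X 2 ^ 3 := by
  have h2 : (3 : A K) * C (2 / 3) = 2 := C_mul_ofNat K (by norm_num)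
  simp only [y, Matrix.cons_val]
  linear_combination - X 2 ^ 3 * h2

/-- `Ω₁` is a Casimir element. -/
theorem bracketMap_Ω₁ (f : A K) : bracketMap K f (Ω₁ K) = 0 := by
  refine bracketMap_eq_zero_of_X K (fun i => ?_) f
  have h : 2 * bracketMap K (X i) (Ω₁ K) = 0 := by
    rw [← bracketMap_ofNat_mul, two_mul_Ω₁]
    fin_cases i <;>
    simp [bracketMap_leibniz, pow_succ, bracketMap_X_X, bracketMap_ofNat, genBracket,
      lowerBracket] <;> ring
  simpa using h

set_option maxHeartbeats 400000 in
/-- `Ω₂` is a Casimir element. -/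
theorem bracketMap_Ω₂ (f : A K) : bracketMap K f (Ω₂ K) = 0 := by
  refine bracketMap_eq_zero_of_X K (fun i => ?_) f
  have h : 6 * bracketMap K (X i) (Ω₂ K) = 0 := by
    rw [← bracketMap_ofNat_mul, six_mul_Ω₂]
    fin_cases i <;>
    simp [bracketMap_leibniz, pow_succ, bracketMap_X_X, bracketMap_ofNat, genBracket,
      lowerBracket] <;> ring
  simpa using h

theorem bracketMap_X_y_two_mul (i : Fin 6) : 2 * bracketMap K (X i) (y K 2) =
    2 * genBracket K i 0 * X 2 + 2 * X 0 * genBracket K i 2 - genBracket K i 1 := by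
  rw [← bracketMap_ofNat_mul, two_mul_y_two]
  simp [bracketMap_leibniz, bracketMap_ofNat, bracketMap_X_X]

theorem bracketMap_X_y_three_mul (i : Fin 6) : 3 * bracketMap K (X i) (y K 3) =
    3 * genBracket K i 1 * X 3 + 3 * X 1 * genBracket K i 3
      - 6 * X 2 ^ 2 * genBracket K i 2 := by
  rw [← bracketMap_ofNat_mul, three_mul_y_three]
  simp [bracketMap_leibniz, bracketMap_ofNat, pow_succ, bracketMap_X_X]
  ring

/-- The right side equals 2Ω₁ − 2X₅·`y K 2`, so a Poisson ideal containing `y K 2` contains Ω₁. The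
next lemma plays the same role for `y K 3` and Ω₂. -/
theorem bracketMap_X_four_y_two :
    bracketMap K (X 4) (y K 2) = X 2 ^ 2 - 3 * X 0 * X 3 := by
  have h := bracketMap_X_y_two_mul K 4
  simp [genBracket, lowerBracket] at h
  refine mul_left_cancel₀ (two_ne_zero (α := A K)) ?_
  linear_combination h

theorem bracketMap_X_five_y_three :
    bracketMap K (X 5) (y K 3) = 6 * (Ω₂ K - y K 3 * X 5) := by
  have h := bracketMap_X_y_three_mul K 5
  simp [genBracket, lowerBracket] at h
  refine mul_left_cancel₀ (OfNat.ofNat_ne_zero 3 : (3 : A K) ≠ 0) ?_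
  linear_combination h - 3 * six_mul_Ω₂ K + 6 * X 5 * three_mul_y_three K

theorem bracketMap_y_of_lt (i j : Fin 4) (hij : i < j) :
    bracketMap K (y K i) (y K j) = C (lam i j : K) * (y K i * y K j) := by
  have e0 : y K 0 = X 0 := rfl
  have e1 : y K 1 = X 1 := rfl
  have e2 := two_mul_y_two K
  have e3 := three_mul_y_three K
  have b3 (i) := bracketMap_X_y_three_mul K i
  have c3 : (C (3 : K) : A K) = 3 := map_ofNat C 3
  fin_cases i <;> fin_cases j <;> first | (exact absurd hij (by decide)) | skip
  · simp [e0, e1, bracketMap_X_X, genBracket, lowerBracket, lam, c3]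
    ring
  · have h := bracketMap_X_y_two_mul K 0
    simp [genBracket, lowerBracket] at h
    simp [e0, lam]
    refine mul_left_cancel₀ (two_ne_zero (α := A K)) ?_
    linear_combination h - X 0 * e2
  · have h := b3 0
    simp [genBracket, lowerBracket] at h
    simp [e0, lam, c3]
    refine mul_left_cancel₀ (OfNat.ofNat_ne_zero 3 : (3 : A K) ≠ 0) ?_
    linear_combination h - 3 * X 0 * e3
  · have h := bracketMap_X_y_two_mul K 1
    simp [genBracket, lowerBracket] at h
    simp [e1, lam]
    refine mul_left_cancel₀ (two_ne_zero (α := A K)) ?_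
    linear_combination h
  · have h := b3 1
    simp [genBracket, lowerBracket] at h
    simp [e1, lam, c3]
    refine mul_left_cancel₀ (OfNat.ofNat_ne_zero 3 : (3 : A K) ≠ 0) ?_
    linear_combination h - 3 * X 1 * e3
  · have h0 := b3 0
    have h1 := b3 1
    have h2 := b3 2
    simp [genBracket, lowerBracket] at h0 h1 h2
    simp [lam, c3]
    have h : 2 * bracketMap K (y K 2) (y K 3) = 2 * bracketMap K (X 0) (y K 3) * X 2
        + 2 * X 0 * bracketMap K (X 2) (y K 3) - bracketMap K (X 1) (y K 3) := by
      rw [← bracketMap_ofNat_mul_left, e2]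
      simp [bracketMap_mul_left, bracketMap_ofNat_left]
    refine mul_left_cancel₀ (OfNat.ofNat_ne_zero 6 : (6 : A K) ≠ 0) ?_
    linear_combination 3 * h + 2 * X 2 * h0 + 2 * X 0 * h2 - h1 - 9 * y K 3 * e2
      - (6 * X 0 * X 2 - 3 * X 1) * e3

theorem bracketMap_y (i j : Fin 4) :
    bracketMap K (y K i) (y K j) = C (lam i j : K) * (y K i * y K j) := by
  rcases lt_trichotomy i j with h | rfl | h
  · exact bracketMap_y_of_lt K i j h
  · have : lam i i = 0 := by fin_cases i <;> rfl
    rw [this, bracketMap_self]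
    simp
  · have : lam i j = - lam j i := by fin_cases i <;> fin_cases j <;> rfl
    rw [bracketMap_skew, bracketMap_y_of_lt K j i h, this]
    push_cast
    rw [C_neg]
    ring

end LogCanonical

/-! ### Localization at the yᵢ and separation of weights -/

section Separation

variable (K : Type*) [Field K]

/-- The substitution `Y₁ ↦ Ω₁`, `Y₂ ↦ Ω₂`. -/
noncomputable def evalΩ : MvPolynomial (Fin 2) K →ₐ[K] A K :=
  aeval ![Ω₁ K, Ω₂ K]

/-- The substitution of `Ω₁`, `Ω₂` for the coefficient variables and of the `yᵢ` for the
variables. -/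
noncomputable def evalY : MvPolynomial (Fin 4) (MvPolynomial (Fin 2) K) →+* A K :=
  eval₂Hom (evalΩ K : MvPolynomial (Fin 2) K →+* A K) (y K)

theorem evalY_C (c : MvPolynomial (Fin 2) K) : evalY K (C c) = evalΩ K c := by
  simp [evalY]

theorem evalY_X (i : Fin 4) : evalY K (X i) = y K i := by
  simp [evalY]

theorem evalY_monomial (d : Fin 4 →₀ ℕ) (c : MvPolynomial (Fin 2) K) :
    evalY K (monomial d c) = evalΩ K c * ∏ i, y K i ^ d i := by
  simp [evalY, eval₂_monomial, Finsupp.prod_fintype]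

theorem evalY_eq_sum (b : MvPolynomial (Fin 4) (MvPolynomial (Fin 2) K)) :
    evalY K b = ∑ d ∈ b.support, evalΩ K (coeff d b) * ∏ i, y K i ^ d i := by
  conv_lhs => rw [b.as_sum, map_sum]
  exact Finset.sum_congr rfl fun d _ => evalY_monomial K d _

theorem evalY_mem_of_coeff_mem {Q : Ideal (A K)}
    {b : MvPolynomial (Fin 4) (MvPolynomial (Fin 2) K)} (h : ∀ d, evalΩ K (coeff d b) ∈ Q) :
    evalY K b ∈ Q := by
  rw [evalY_eq_sum]
  exact sum_mem fun d _ => Q.mul_mem_right _ (h d)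

/-- The `yᵢ` are non-zero-divisors modulo `Q`. -/
def YRegular (Q : Ideal (A K)) : Prop :=
  ∀ i a, y K i * a ∈ Q → a ∈ Q

variable {K} in
theorem YRegular.prod_pow {Q : Ideal (A K)} (hQ : YRegular K Q) (d : Fin 4 → ℕ) {a : A K}
    (h : (∏ i, y K i ^ d i) * a ∈ Q) : a ∈ Q := by
  have hpow : ∀ i n a, y K i ^ n * a ∈ Q → a ∈ Q := by
    intro i n
    induction n with
    | zero => intro a h; simpa using h
    | succ n ih => intro a h; rw [pow_succ, mul_assoc] at h; exact hQ i _ (ih _ h)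
  rw [Fin.prod_univ_four, mul_assoc, mul_assoc, mul_assoc] at h
  exact hpow _ _ _ (hpow _ _ _ (hpow _ _ _ (hpow _ _ _ h)))

/-- Simultaneous eigenvectors of the derivations `yᵢ⁻¹{yᵢ, ·}` with distinct weights whose sum
lies in a Poisson ideal all lie in it. -/
theorem mem_of_sum_mem {ι : Type*} {P : Ideal (A K)} (hP : (bracket K).IsPoissonIdeal P)
    (hreg : YRegular K P) (w : ι → Fin 4 → K) (S : Finset ι) (v : ι → A K)
    (hv : ∀ m i, bracketMap K (y K i) (v m) = C (w m i) * (y K i * v m))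
    (hw : ∀ m ∈ S, ∀ m' ∈ S, m ≠ m' → ∃ i, w m i ≠ w m' i)
    (h : ∑ m ∈ S, v m ∈ P) : ∀ m ∈ S, v m ∈ P := by
  classical
  induction S using Finset.induction_on generalizing v with
  | empty => simp
  | insert m₀ S hm₀ ih =>
    have hS : ∀ m ∈ S, v m ∈ P := by
      intro m hm
      obtain ⟨i, hi⟩ := hw m (Finset.mem_insert_of_mem hm) m₀ (Finset.mem_insert_self _ _)
        (by rintro rfl; exact hm₀ hm)
      -- Subtracting w(m₀, i)·yᵢ times the sum from its bracket kills the m₀ term and scales every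
      -- other term by a difference of weights; the common factor yᵢ cancels by regularity.
      have h1 : bracketMap K (y K i) (∑ m ∈ insert m₀ S, v m) ∈ P := hP _ _ h
      have h2 := sub_mem h1 (P.mul_mem_left (C (w m₀ i) * y K i) h)
      have h3 : y K i * ∑ m ∈ S, C (w m i - w m₀ i) * v m ∈ P := by
        convert h2 using 1
        rw [map_sum, Finset.sum_insert hm₀, Finset.sum_insert hm₀, hv, mul_add, mul_assoc,
          add_sub_add_left_eq_sub, Finset.mul_sum, Finset.mul_sum, ← Finset.sum_sub_distrib]
        refine Finset.sum_congr rfl fun m _ => ?_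
        rw [hv, C_sub]
        ring
      have h4 := ih (fun m => C (w m i - w m₀ i) * v m)
        (fun m j => by
          rw [bracketMap_leibniz, bracketMap_C, hv]
          ring)
        (fun m hm m' hm' => hw m (Finset.mem_insert_of_mem hm) m' (Finset.mem_insert_of_mem hm'))
        (hreg i _ h3) m hm
      have h5 := P.mul_mem_left (C (w m i - w m₀ i)⁻¹) h4
      rwa [← mul_assoc, ← C_mul, inv_mul_cancel₀ (sub_ne_zero.mpr hi), C_1, one_mul] at h5
    intro m hm
    rcases Finset.mem_insert.mp hm with rfl | hm
    · rw [Finset.sum_insert hm₀] at h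
      exact (Ideal.add_mem_iff_left _ (sum_mem hS)).mp h
    · exact hS m hm

/-- The elements of `A` which a power of `y₁y₂y₃y₄` multiplies into the subalgebra generated by
the `yᵢ` and the `Ωᵢ`. -/
noncomputable def localizedSubring : Subring (A K) where
  carrier := {a | ∃ n : ℕ, (∏ i, y K i) ^ n * a ∈ (evalY K).range}
  mul_mem' := by
    rintro u v ⟨n, hn⟩ ⟨m, hm⟩
    refine ⟨n + m, ?_⟩
    convert mul_mem hn hm using 1
    ring
  one_mem' := ⟨0, by simp⟩
  add_mem' := by
    have hy : ∀ n : ℕ, (∏ i, y K i) ^ n ∈ (evalY K).range := fun n =>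
      pow_mem (prod_mem fun i _ => RingHom.mem_range.mpr ⟨X i, evalY_X K i⟩) n
    rintro u v ⟨n, hn⟩ ⟨m, hm⟩
    refine ⟨n + m, ?_⟩
    convert add_mem (mul_mem (hy m) hn) (mul_mem (hy n) hm) using 1
    ring
  zero_mem' := ⟨0, by simp⟩
  neg_mem' := by
    rintro u ⟨n, hn⟩
    exact ⟨n, by simpa using neg_mem hn⟩

theorem evalY_mem_localizedSubring (b : MvPolynomial (Fin 4) (MvPolynomial (Fin 2) K)) :
    evalY K b ∈ localizedSubring K :=
  ⟨0, by simp⟩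

theorem mem_localizedSubring_of_mul (i : Fin 4) {a : A K}
    (h : y K i * a ∈ localizedSubring K) : a ∈ localizedSubring K := by
  obtain ⟨n, hn⟩ := h
  refine ⟨n + 1, ?_⟩
  have h1 : ∏ j ∈ Finset.univ.erase i, y K j ∈ (evalY K).range :=
    prod_mem fun j _ => RingHom.mem_range.mpr ⟨X j, evalY_X K j⟩
  convert mul_mem h1 hn using 1
  rw [pow_succ, ← Finset.mul_prod_erase _ (y K) (Finset.mem_univ i)]
  ring

/-- The system is triangular: `y K 2`, `y K 3`, Ω₁, Ω₂ are linear in X₃, X₄, X₅, X₆ with leading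
coefficients `y K 0`, `y K 1`, `y K 2`, `y K 3`, and the remaining terms involve only earlier
variables. -/
theorem mem_localizedSubring (a : A K) : a ∈ localizedSubring K := by
  have hC : ∀ c : K, C c ∈ localizedSubring K := fun c => by
    have := evalY_mem_localizedSubring K (C (C c))
    rwa [evalY_C, ← algebraMap_eq, AlgHom.commutes] at this
  have hy : ∀ i, y K i ∈ localizedSubring K := fun i =>
    evalY_X K i ▸ evalY_mem_localizedSubring K (X i)
  have hΩ : ∀ i, ![Ω₁ K, Ω₂ K] i ∈ localizedSubring K := fun i => by
    have := evalY_mem_localizedSubring K (C (X i))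
    rwa [evalY_C, evalΩ, aeval_X] at this
  have h0 : X 0 ∈ localizedSubring K := hy 0
  have h1 : X 1 ∈ localizedSubring K := hy 1
  have hn : ∀ n : ℕ, (n : A K) ∈ localizedSubring K := fun n => natCast_mem _ n
  have h2 : X 2 ∈ localizedSubring K := by
    refine mem_localizedSubring_of_mul K 0 ?_
    have e : y K 0 * X 2 = y K 2 + C (1 / 2) * X 1 := by simp [y]
    rw [e]
    exact add_mem (hy 2) (mul_mem (hC _) h1)
  have h3 : X 3 ∈ localizedSubring K := by
    refine mem_localizedSubring_of_mul K 1 ?_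
    have e : y K 1 * X 3 = y K 3 + C (2 / 3) * X 2 ^ 3 := by simp [y]
    rw [e]
    exact add_mem (hy 3) (mul_mem (hC _) (pow_mem h2 3))
  have h4 : X 4 ∈ localizedSubring K := by
    refine mem_localizedSubring_of_mul K 2 ?_
    have e : y K 2 * X 4 = Ω₁ K + C (3 / 2) * X 0 * X 3 - C (1 / 2) * X 2 ^ 2 := by
      simp only [y, Ω₁, Matrix.cons_val]
      ring
    rw [e]
    exact sub_mem (add_mem (hΩ 0) (mul_mem (mul_mem (hC _) h0) h3))
      (mul_mem (hC _) (pow_mem h2 2))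
  have h5 : X 5 ∈ localizedSubring K := by
    refine mem_localizedSubring_of_mul K 3 ?_
    have e : y K 3 * X 5 = Ω₂ K + C (2 / 3) * X 1 * X 4 ^ 3 - ((2 : ℕ) : A K) * X 2 ^ 2 * X 4 ^ 2
        + ((3 : ℕ) : A K) * X 2 * X 3 * X 4 - C (3 / 2) * X 3 ^ 2 := by
      simp only [y, Ω₂, Matrix.cons_val]
      push_cast
      ring
    rw [e]
    exact sub_mem (add_mem (sub_mem (add_mem (hΩ 1) (mul_mem (mul_mem (hC _) h1) (pow_mem h4 3)))
      (mul_mem (mul_mem (hn 2) (pow_mem h2 2)) (pow_mem h4 2)))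
      (mul_mem (mul_mem (mul_mem (hn 3) h2) h3) h4)) (mul_mem (hC _) (pow_mem h3 2))
  induction a using MvPolynomial.induction_on with
  | C c => exact hC c
  | add p q hp hq => exact add_mem hp hq
  | mul_X p i hp =>
    refine mul_mem hp ?_
    fin_cases i <;> assumption

theorem exists_pow_mul_eq_evalY (a : A K) : ∃ (n : ℕ) (b : _),
    evalY K b = (∏ i, y K i ^ n) * a := by
  obtain ⟨n, b, hb⟩ := mem_localizedSubring K a
  exact ⟨n, b, by rw [hb, Finset.prod_pow]⟩

variable [CharZero K]

theorem bracketMap_evalΩ (f : A K) (c : MvPolynomial (Fin 2) K) :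
    bracketMap K f (evalΩ K c) = 0 := by
  induction c using MvPolynomial.induction_on with
  | C c => rw [← algebraMap_eq, AlgHom.commutes]; exact bracketMap_C K f c
  | add p q hp hq => rw [map_add, map_add, hp, hq, add_zero]
  | mul_X p i hp =>
    rw [map_mul, bracketMap_leibniz, hp]
    have : bracketMap K f (evalΩ K (X i)) = 0 := by
      fin_cases i
      · simpa [evalΩ] using bracketMap_Ω₁ K f
      · simpa [evalΩ] using bracketMap_Ω₂ K f
    rw [this]
    ring

theorem isPoissonIdeal_map_evalΩ (I : Ideal (MvPolynomial (Fin 2) K)) :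
    (bracket K).IsPoissonIdeal (I.map (evalΩ K)) := by
  refine (bracket K).isPoissonIdeal_span_of_central ?_
  rintro _ ⟨c, _, rfl⟩ a
  exact bracketMap_evalΩ K a c

/-- The weights of the monomials in the `yᵢ`. -/
def wt (d : Fin 4 →₀ ℕ) (i : Fin 4) : K :=
  ((∑ j, lam i j * d j : ℤ) : K)

/-- The skew matrix `lam` has Pfaffian 3·3 − 1·3 + 3·0 = 6, so the weights determine the exponents;
characteristic zero reduces this to integers. -/
theorem wt_injective {d e : Fin 4 →₀ ℕ} (h : d ≠ e) : ∃ i, wt K d i ≠ wt K e i := by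
  by_contra! H
  simp only [wt, Int.cast_inj, Fin.sum_univ_four] at H
  have h0 := H 0
  have h1 := H 1
  have h2 := H 2
  have h3 := H 3
  simp [lam] at h0 h1 h2 h3
  apply h
  ext i
  fin_cases i <;> simp <;> omega

theorem bracketMap_y_pow (i j : Fin 4) (n : ℕ) : bracketMap K (y K i) (y K j ^ n) =
    C ((lam i j * n : ℤ) : K) * (y K i * y K j ^ n) := by
  have h := (bracket K).br_pow (y K i) (y K j) n
  change bracketMap K _ _ = _ * bracketMap K _ _ at h
  rw [h, bracketMap_y]
  rcases n with _ | n
  · simp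
  · push_cast
    simp only [C_mul, C_add, map_natCast, C_1]
    ring

theorem bracketMap_y_monomial (i : Fin 4) (d : Fin 4 →₀ ℕ) (c : MvPolynomial (Fin 2) K) :
    bracketMap K (y K i) (evalΩ K c * ∏ j, y K j ^ d j) =
      C (wt K d i) * (y K i * (evalΩ K c * ∏ j, y K j ^ d j)) := by
  rw [bracketMap_leibniz, bracketMap_evalΩ]
  simp only [Fin.prod_univ_four, bracketMap_leibniz, bracketMap_y_pow, wt, Fin.sum_univ_four,
    Int.cast_add, C_add]
  ring

/-- The terms c(Ω)·yᵈ are simultaneous eigenvectors with distinct weights, so each lies in P, and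
regularity removes yᵈ. -/
theorem evalΩ_coeff_mem {P : Ideal (A K)} (hP : (bracket K).IsPoissonIdeal P)
    (hreg : YRegular K P) {b : MvPolynomial (Fin 4) (MvPolynomial (Fin 2) K)}
    (h : evalY K b ∈ P) (d : Fin 4 →₀ ℕ) : evalΩ K (coeff d b) ∈ P := by
  by_cases hd : d ∈ b.support
  · rw [evalY_eq_sum] at h
    have := mem_of_sum_mem K hP hreg (wt K) b.support _
      (fun m i => bracketMap_y_monomial K i m (coeff m b)) (fun _ _ _ _ => wt_injective K) h d hd
    rw [mul_comm] at this
    exact hreg.prod_pow d this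
  · rw [notMem_support_iff.mp hd, map_zero]
    exact zero_mem _

/-- A Poisson ideal modulo which the `yᵢ` are regular is generated by Casimir elements. -/
theorem le_map_comap_evalΩ {P : Ideal (A K)} (hP : (bracket K).IsPoissonIdeal P)
    (hreg : YRegular K P) (hQ : YRegular K ((P.comap (evalΩ K)).map (evalΩ K))) :
    P ≤ (P.comap (evalΩ K)).map (evalΩ K) := by
  intro a ha
  obtain ⟨n, b, hb⟩ := exists_pow_mul_eq_evalY K a
  refine hQ.prod_pow (fun _ => n) (hb ▸ evalY_mem_of_coeff_mem K fun d => ?_)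
  exact Ideal.mem_map_of_mem _ (evalΩ_coeff_mem K hP hreg (hb ▸ P.mul_mem_left _ ha) d)

end Separation

/-! ### Points on yᵢ = 0 and regularity of the yᵢ -/

section Points

variable (K : Type*) [Field K]

theorem eval_evalΩ (x : Fin 6 → K) (p : MvPolynomial (Fin 2) K) :
    eval x (evalΩ K p) = eval ![eval x (Ω₁ K), eval x (Ω₂ K)] p := by
  have h : (aeval x).comp (evalΩ K) =
      (aeval ![eval x (Ω₁ K), eval x (Ω₂ K)] : MvPolynomial (Fin 2) K →ₐ[K] K) := by
    ext i
    fin_cases i <;> simp [evalΩ, aeval_eq_eval]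
  exact DFunLike.congr_fun h p

theorem eq_top_of_C_mem {J : Ideal (A K)} {α : K} (hα : α ≠ 0) (h : C α ∈ J) : J = ⊤ :=
  J.eq_top_of_isUnit_mem h ((IsUnit.mk0 α hα).map C)

variable [CharZero K]

theorem exists_eval_Ω (a b : K) :
    ∃ x : Fin 6 → K, eval x (y K 0) = 0 ∧ eval x (Ω₁ K) = a ∧ eval x (Ω₂ K) = b := by
  -- At X₁ = X₃ = 0, X₂ = X₄ = 1 the equations become −X₅/2 = a and X₆ − (2/3)X₅³ + 3/2 = b.
  refine ⟨![0, 1, 0, 1, -2 * a, b - 3 / 2 - 16 / 3 * a ^ 3], ?_, ?_, ?_⟩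
  · simp [y]
  · simp [Ω₁]
  · simp [Ω₂]
    ring

theorem exists_eval_y_eq_zero [IsAlgClosed K] (i : Fin 4) {a b : K} (ha : a ≠ 0) (hb : b ≠ 0) :
    ∃ x : Fin 6 → K, eval x (y K i) = 0 ∧ eval x (Ω₁ K) = a ∧ eval x (Ω₂ K) = b := by
  fin_cases i
  · exact exists_eval_Ω K a b
  · refine ⟨![(1 - 2 * a) / 3, 0, 1, 1, 0, (3 / 2 - b) * (3 / 2)], ?_, ?_, ?_⟩
    · simp [y]
    · simp [Ω₁]
      ring
    · simp [Ω₂]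
      ring
  -- Here X₂ = 2X₁X₃ and X₅ = 0. Solving Ω₁ = a for X₄ leaves X₆ with coefficient −4a/3 in Ω₂, so a
  -- ≠ 0 is needed.
  · refine ⟨![1, 2, 1, (1 - 2 * a) / 3, 0,
      (b - 3 / 2 * ((1 - 2 * a) / 3) ^ 2) * (-3 / (4 * a))], ?_, ?_, ?_⟩
    · simp [y]
    · simp [Ω₁]
      ring
    · simp [Ω₂]
      field_simp
      ring
  -- With only X₁ and X₄ = t nonzero, Ω₂ = (3/2)t² and Ω₁ = −(3/2)X₁t; b ≠ 0 allows division by t.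
  · obtain ⟨t, ht⟩ := IsAlgClosed.exists_pow_nat_eq (2 / 3 * b) (n := 2) (by norm_num)
    have ht0 : t ≠ 0 := by
      rintro rfl
      simp [hb] at ht
    refine ⟨![-2 * a / (3 * t), 0, 0, t, 0, 0], ?_, ?_, ?_⟩
    · simp [y]
    · simp [Ω₁]
      field_simp
    · simp [Ω₂]
      rw [ht]
      field_simp

/-- Divisibility would make p vanish on all of (K*)², so p·Y₁Y₂ would vanish on the whole plane. -/
theorem not_y_dvd_evalΩ [IsAlgClosed K] (i : Fin 4) {p : MvPolynomial (Fin 2) K} (hp : p ≠ 0) :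
    ¬ y K i ∣ evalΩ K p := by
  rintro ⟨q, hq⟩
  have h : p * (X 0 * X 1) = 0 := by
    refine MvPolynomial.funext fun c => ?_
    by_cases h0 : c 0 = 0
    · simp [h0]
    by_cases h1 : c 1 = 0
    · simp [h1]
    obtain ⟨x, hx, hx1, hx2⟩ := exists_eval_y_eq_zero K i h0 h1
    have h2 := congrArg (eval x) hq
    rw [eval_evalΩ, hx1, hx2, map_mul, hx, zero_mul] at h2
    have e : ![c 0, c 1] = c := by
      ext j
      fin_cases j <;> rfl
    rw [e] at h2
    rw [map_mul, h2, zero_mul, map_zero]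
  rcases mul_eq_zero.mp h with h | h
  · exact hp h
  · exact mul_ne_zero (X_ne_zero _) (X_ne_zero _) h

/-- The last two are irreducible as linear polynomials with coprime coefficients: `y K 2` in X₂ with
a unit coefficient, `y K 3` in X₄ with coefficient X₂, which does not divide X₃³. -/
theorem prime_y (i : Fin 4) : Prime (y K i) := by
  fin_cases i
  · exact X_prime
  · exact X_prime
  · rw [← UniqueFactorizationMonoid.irreducible_iff_prime]
    have hu : IsUnit (C (-(1 / 2)) : A K) :=
      (IsUnit.mk0 _ (by norm_num : (-(1 / 2) : K) ≠ 0)).map C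
    have h := irreducible_mul_X_add (C (-(1 / 2)) : A K) (X 0 * X 2) 1 hu.ne_zero
      (by rw [vars_C]; simp)
      (fun h => by
        classical
        have := vars_mul _ _ h
        simp [vars_X] at this)
      (hu.isRelPrime_left)
    have e : y K 2 = C (-(1 / 2)) * X 1 + X 0 * X 2 := by
      simp only [y, C_neg, Matrix.cons_val]
      ring
    exact e ▸ h
  · rw [← UniqueFactorizationMonoid.irreducible_iff_prime]
    have h := irreducible_mul_X_add (X 1 : A K) (C (-(2 / 3)) * X 2 ^ 3) 3 (X_ne_zero _)
      (by simp [vars_X])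
      (fun h => by
        classical
        rcases Finset.mem_union.mp (vars_mul _ _ h) with h | h
        · simp at h
        · have := vars_pow _ _ h
          simp [vars_X] at this)
      (by
        refine (X_prime.irreducible.isRelPrime_iff_not_dvd).mpr ?_
        rintro ⟨q, hq⟩
        have := congrArg (eval ![0, 0, 1, 0, 0, 0]) hq
        simp at this)
    have e : y K 3 = X 1 * X 3 + C (-(2 / 3)) * X 2 ^ 3 := by
      simp only [y, C_neg, Matrix.cons_val]
      ring
    exact e ▸ h

theorem yRegular_bot : YRegular K ⊥ := by
  intro i a h
  rw [Ideal.mem_bot] at h ⊢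
  exact (mul_eq_zero.mp h).resolve_left (prime_y K i).ne_zero

theorem yRegular_span_evalΩ [IsAlgClosed K] {p : MvPolynomial (Fin 2) K} (hp : p ≠ 0) :
    YRegular K (Ideal.span {evalΩ K p}) := by
  intro i a h
  rw [Ideal.mem_span_singleton] at h ⊢
  obtain ⟨c, hc⟩ := h
  have h1 : y K i ∣ evalΩ K p * c := hc ▸ dvd_mul_right _ _
  obtain ⟨d, rfl⟩ := ((prime_y K i).dvd_or_dvd h1).resolve_left (not_y_dvd_evalΩ K i hp)
  refine ⟨d, mul_left_cancel₀ (prime_y K i).ne_zero ?_⟩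
  rw [hc]
  ring

/-- By `IsPoissonIdeal.mem_of_mul_mem` it is enough that a radical Poisson ideal J containing these
generators and yᵢ is the unit ideal. Brackets with the Xⱼ bring Ω₁ or Ω₂ into J, hence the nonzero
constant α or β. -/
theorem yRegular_span_sub {α β : K} (hα : α ≠ 0) (hβ : β ≠ 0) :
    YRegular K (Ideal.span {Ω₁ K - C α, Ω₂ K - C β}) := by
  intro i a h
  refine PoissonBracket.IsPoissonIdeal.mem_of_mul_mem (B := bracket K) ?_ ?_ h
  · refine (bracket K).isPoissonIdeal_span_of_central ?_
    rintro s (rfl | rfl) a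
    · change bracketMap K a _ = 0
      rw [map_sub, bracketMap_Ω₁, bracketMap_C, sub_zero]
    · change bracketMap K a _ = 0
      rw [map_sub, bracketMap_Ω₂, bracketMap_C, sub_zero]
  intro J hJ hrad hle hy
  have h1 : Ω₁ K ∈ J → J = ⊤ := fun h => eq_top_of_C_mem K hα
    (by simpa using sub_mem h (hle (Ideal.subset_span (Set.mem_insert _ _))))
  have h2 : Ω₂ K ∈ J → J = ⊤ := fun h => eq_top_of_C_mem K hβ
    (by simpa using sub_mem h (hle (Ideal.subset_span (Set.mem_insert_of_mem _ rfl))))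
  have hbr : ∀ (i j : Fin 6), X j ∈ J → genBracket K i j ∈ J := fun i j h => by
    have := hJ (X i) _ h
    rwa [← bracketMap_X_X]
  have hcast : ∀ (n : ℕ) [n.AtLeastTwo] (f : A K), ofNat(n) * f ∈ J → f ∈ J :=
    fun n _ f h => PoissonBracket.natCast_mul_mem K (n := n) (NeZero.ne n) h
  -- The bracket {X₅, X₃} = −X₃X₅ − 3X₄ adds X₄ to J, and every term of Ω₁ contains X₂, X₃ or X₄.
  have hX2 : X 1 ∈ J → X 2 ∈ J → J = ⊤ := fun hX1 hX2 => h1 <| by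
    have h3 : X 3 ∈ J := by
      have := hbr 4 2 hX2
      simp [genBracket, lowerBracket] at this
      refine hcast 3 _ ?_
      convert neg_mem (add_mem this (J.mul_mem_right (X 4) hX2)) using 1
      ring
    simp only [Ω₁]
    refine add_mem (sub_mem (sub_mem ?_ ?_) ?_) ?_
    · exact J.mul_mem_right _ (J.mul_mem_left _ hX2)
    · exact J.mul_mem_left _ h3
    · exact J.mul_mem_right _ (J.mul_mem_left _ hX1)
    · exact J.mul_mem_left _ (J.pow_mem_of_mem hX2 2 (by norm_num))
  fin_cases i
  -- {X₃, X₁} yields X₂, and {X₄, X₁} = −2X₃² yields X₃ by radicality.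
  · have hX0 : X 0 ∈ J := hy
    refine hX2 ?_ ?_
    · have := hbr 2 0 hX0
      simp [genBracket, lowerBracket] at this
      convert neg_mem (add_mem this (J.mul_mem_right (X 2) hX0)) using 1
      ring
    · have := hbr 3 0 hX0
      simp [genBracket, lowerBracket] at this
      exact hrad ⟨2, hcast 2 _ this⟩
  · have hX1 : X 1 ∈ J := hy
    refine hX2 hX1 ?_
    have := hbr 4 1 hX1
    simp [genBracket, lowerBracket] at this
    exact hrad ⟨2, hcast 6 _ this⟩
  · refine h1 (hcast 2 _ ?_)
    have h3 : bracketMap K (X 4) (y K 2) ∈ J := hJ (X 4) _ hy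
    rw [bracketMap_X_four_y_two] at h3
    have hy' : y K 2 ∈ J := hy
    convert add_mem h3 (J.mul_mem_left (2 * X 4) hy') using 1
    linear_combination two_mul_Ω₁ K - X 4 * two_mul_y_two K
  · refine h2 ?_
    have h3 : bracketMap K (X 5) (y K 3) ∈ J := hJ (X 5) _ hy
    rw [bracketMap_X_five_y_three] at h3
    have hy' : y K 3 ∈ J := hy
    simpa using add_mem (hcast 6 _ h3) (J.mul_mem_right (X 5) hy')

end Points

/-! ### Extension and contraction of primes between K[Y₁, Y₂] and 𝒜 -/

section Contraction

variable (K : Type*) [Field K]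

theorem map_evalΩ_span_pair (α β : K) :
    (Ideal.span {X 0 - C α, X 1 - C β}).map (evalΩ K) =
      Ideal.span {Ω₁ K - C α, Ω₂ K - C β} := by
  rw [Ideal.map_span, Set.image_pair]
  have hC : ∀ c : K, evalΩ K (C c) = C c := fun c => by
    rw [← algebraMap_eq, AlgHom.commutes]
    rfl
  rw [map_sub, map_sub, hC, hC]
  simp [evalΩ]

variable [CharZero K] [IsAlgClosed K]

/-- Every zero of I is the value of (Ω₁, Ω₂) at some point of K⁶, and evaluation there kills the
extended ideal. A contracted element thus vanishes on the zero locus of I, and the Nullstellensatz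
applies. -/
theorem comap_map_evalΩ (I : Ideal (MvPolynomial (Fin 2) K)) [I.IsPrime] :
    (I.map (evalΩ K)).comap (evalΩ K) = I := by
  refine le_antisymm (fun c hc => ?_) Ideal.le_comap_map
  rw [← IsPrime.vanishingIdeal_zeroLocus (K := K) I, mem_vanishingIdeal_iff]
  intro a ha
  obtain ⟨x, -, h1, h2⟩ := exists_eval_Ω K (a 0) (a 1)
  have e : ![a 0, a 1] = a := by
    ext j
    fin_cases j <;> rfl
  have key : ∀ p, eval x (evalΩ K p) = aeval a p := fun p => by
    rw [eval_evalΩ, h1, h2, e, aeval_eq_eval]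
  have hle : I.map (evalΩ K) ≤ RingHom.ker (eval x) := by
    rw [Ideal.map_le_iff_le_comap]
    intro p hp
    rw [Ideal.mem_comap, RingHom.mem_ker, key]
    exact ha p hp
  rw [← key]
  exact hle hc

theorem evalY_mem_map_iff (I : Ideal (MvPolynomial (Fin 2) K)) [I.IsPrime]
    (hreg : YRegular K (I.map (evalΩ K))) (b : MvPolynomial (Fin 4) (MvPolynomial (Fin 2) K)) :
    evalY K b ∈ I.map (evalΩ K) ↔ b ∈ I.map C := by
  rw [mem_map_C_iff]
  refine ⟨fun h d => ?_, fun h => evalY_mem_of_coeff_mem K fun d => Ideal.mem_map_of_mem _ (h d)⟩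
  have h1 := evalΩ_coeff_mem K (isPoissonIdeal_map_evalΩ K I) hreg h d
  rwa [← Ideal.mem_comap, comap_map_evalΩ] at h1

/-- Multiplying by powers of the yᵢ moves both factors into the image of K[Y₁, Y₂][y], where
membership is tested on coefficients by `evalY_mem_map_iff`; the coefficientwise extension of I is
prime, and regularity removes the powers. -/
theorem isPrime_map_evalΩ (I : Ideal (MvPolynomial (Fin 2) K)) [hI : I.IsPrime]
    (hreg : YRegular K (I.map (evalΩ K))) : (I.map (evalΩ K)).IsPrime := by
  have hprime : (I.map (C : _ →+* MvPolynomial (Fin 4) (MvPolynomial (Fin 2) K))).IsPrime := by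
    rw [← Ideal.mk_ker (I := I), ← MvPolynomial.ker_map]
    exact RingHom.ker_isPrime _
  refine ⟨fun h => ?_, fun {u v} huv => ?_⟩
  · apply hI.ne_top
    rw [← comap_map_evalΩ K I, h, Ideal.comap_top]
  · obtain ⟨n, b, hb⟩ := exists_pow_mul_eq_evalY K u
    obtain ⟨m, c, hc⟩ := exists_pow_mul_eq_evalY K v
    have h1 : evalY K (b * c) ∈ I.map (evalΩ K) := by
      rw [map_mul, hb, hc, mul_mul_mul_comm]
      exact Ideal.mul_mem_left _ _ huv
    rw [evalY_mem_map_iff K I hreg] at h1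
    refine (hprime.mem_or_mem h1).imp (fun h => ?_) fun h => ?_
    · exact hreg.prod_pow _ (hb ▸ (evalY_mem_map_iff K I hreg b).mpr h)
    · exact hreg.prod_pow _ (hc ▸ (evalY_mem_map_iff K I hreg c).mpr h)

end Contraction

/-! ### Primes of the polynomial ring in two variables -/

section PlanePrimes

variable {K : Type*} [Field K]

theorem sub_C_eval_mem_span (x : Fin 2 → K) (p : MvPolynomial (Fin 2) K) :
    p - C (eval x p) ∈ Ideal.span {X 0 - C (x 0), X 1 - C (x 1)} := by
  set I : Ideal (MvPolynomial (Fin 2) K) := Ideal.span {X 0 - C (x 0), X 1 - C (x 1)}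
  induction p using MvPolynomial.induction_on with
  | C c => simp
  | add p q hp hq =>
    convert add_mem hp hq using 1
    rw [map_add, C_add]
    ring
  | mul_X p i hp =>
    have hi : X i - C (x i) ∈ I := by
      fin_cases i
      · exact Ideal.subset_span (Set.mem_insert _ _)
      · exact Ideal.subset_span (Set.mem_insert_of_mem _ rfl)
    convert add_mem (I.mul_mem_right (X i) hp) (I.mul_mem_left (C (eval x p)) hi) using 1
    rw [map_mul, eval_X, C_mul]
    ring

theorem vanishingIdeal_singleton (x : Fin 2 → K) :
    vanishingIdeal K {x} = Ideal.span {X 0 - C (x 0), X 1 - C (x 1)} := by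
  refine le_antisymm (fun p hp => ?_) ?_
  · rw [mem_vanishingIdeal_singleton_iff, aeval_eq_eval] at hp
    have hp' : eval x p = 0 := hp
    simpa [hp'] using sub_C_eval_mem_span x p
  · rw [Ideal.span_le]
    rintro _ (rfl | rfl) <;> simp

theorem isPrime_span_pair (α β : K) :
    (Ideal.span {X 0 - C α, X 1 - C β} : Ideal (MvPolynomial (Fin 2) K)).IsPrime := by
  have := vanishingIdeal_singleton ![α, β]
  simp only [Matrix.cons_val] at this
  rw [← this]
  infer_instance

/-- The prime ideals of `K[Y₁, Y₂]` for an algebraically closed field `K`. -/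
theorem isPrime_cases [IsAlgClosed K] (I : Ideal (MvPolynomial (Fin 2) K)) [hI : I.IsPrime] :
    I = ⊥ ∨ (∃ p, Irreducible p ∧ I = Ideal.span {p}) ∨
      ∃ α β : K, I = Ideal.span {X 0 - C α, X 1 - C β} := by
  by_cases h0 : I = ⊥
  · exact Or.inl h0
  obtain ⟨p, hpI, hp⟩ := hI.exists_mem_prime_of_ne_bot h0
  by_cases h1 : I = Ideal.span {p}
  · exact Or.inr (Or.inl ⟨p, hp.irreducible, h1⟩)
  -- Otherwise 0 ⊂ (p) ⊂ I ⊂ M would be a chain of length 3 in a ring of Krull dimension 2.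
  have hmax : I.IsMaximal := by
    by_contra hmax
    obtain ⟨M, hM, hle⟩ := I.exists_le_maximal hI.ne_top
    have hlt : I < M := lt_of_le_of_ne hle fun h => hmax (h ▸ hM)
    have hlt1 : Ideal.span {p} < I :=
      lt_of_le_of_ne ((Ideal.span_singleton_le_iff_mem I).mpr hpI) (Ne.symm h1)
    have hlt0 : (⊥ : Ideal (MvPolynomial (Fin 2) K)) < Ideal.span {p} :=
      bot_lt_iff_ne_bot.mpr fun h => hp.ne_zero (Ideal.span_singleton_eq_bot.mp h)
    have hpp := (Ideal.span_singleton_prime hp.ne_zero).mpr hp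
    let s : LTSeries (PrimeSpectrum (MvPolynomial (Fin 2) K)) :=
      ⟨3, ![⟨⊥, Ideal.isPrime_bot⟩, ⟨_, hpp⟩, ⟨I, hI⟩, ⟨M, hM.isPrime⟩], fun i => by
        fin_cases i
        · exact hlt0
        · exact hlt1
        · exact hlt⟩
    have h := Order.LTSeries.length_le_krullDim s
    change (3 : WithBot ℕ∞) ≤ ringKrullDim (MvPolynomial (Fin 2) K) at h
    rw [ringKrullDim_of_isNoetherianRing, ringKrullDim_eq_zero_of_field, Nat.card_fin,
      zero_add] at h
    exact absurd h (by decide)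
  obtain ⟨x, rfl⟩ := isMaximal_iff_eq_vanishingIdeal_singleton.mp hmax
  exact Or.inr (Or.inr ⟨x 0, x 1, vanishingIdeal_singleton x⟩)

end PlanePrimes

/-! ### The torus action and the zero stratum -/

section Torus

variable (K : Type*) [Field K]

theorem torusAct_X (h : Kˣ × Kˣ) (i : Fin 6) :
    torusAct K h (X i) = C (weight K h i : K) * X i := by
  simp [torusAct]

theorem torusAct_C (h : Kˣ × Kˣ) (c : K) : torusAct K h (C c) = C c := by
  rw [← algebraMap_eq, AlgEquiv.commutes]

theorem torusAct_Ω₁ (h : Kˣ × Kˣ) :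
    torusAct K h (Ω₁ K) = C ((h.1 ^ 4 * h.2 ^ 2 : Kˣ) : K) * Ω₁ K := by
  simp [Ω₁, torusAct_X, torusAct_C, weight, -map_div₀, -one_div]
  ring

theorem torusAct_Ω₂ (h : Kˣ × Kˣ) :
    torusAct K h (Ω₂ K) = C ((h.1 ^ 6 * h.2 ^ 4 : Kˣ) : K) * Ω₂ K := by
  have hn : ∀ n : ℕ, torusAct K h n = n := fun n => map_natCast _ n
  have h2 : torusAct K h 2 = 2 := hn 2
  have h3 : torusAct K h 3 = 3 := hn 3
  simp [Ω₂, torusAct_X, torusAct_C, weight, h2, h3, -map_div₀, -one_div]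
  ring

theorem torusAct_y (h : Kˣ × Kˣ) (i : Fin 4) :
    ∃ c : Kˣ, torusAct K h (y K i) = C (c : K) * y K i := by
  fin_cases i
  · exact ⟨_, torusAct_X K h 0⟩
  · exact ⟨_, torusAct_X K h 1⟩
  · refine ⟨h.1 ^ 3 * h.2, ?_⟩
    simp [y, torusAct_X, torusAct_C, weight, -map_div₀, -one_div]
    ring
  · refine ⟨h.1 ^ 6 * h.2 ^ 3, ?_⟩
    simp [y, torusAct_X, torusAct_C, weight, -map_div₀, -one_div]
    ring

variable {K} in
/-- A member of the zero stratum contains no nonzero homogeneous element. -/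
theorem notMem_of_homogeneous {P : Ideal (A K)} (hP : ⨅ h, P.map (torusAct K h) = ⊥) {f : A K}
    (hf : ∀ h, ∃ c : Kˣ, torusAct K h f = C (c : K) * f) (hf0 : f ≠ 0) : f ∉ P := by
  intro hfP
  apply hf0
  rw [← Ideal.mem_bot, ← hP, Ideal.mem_iInf]
  intro h
  obtain ⟨c, hc⟩ := hf h
  have h1 := Ideal.mul_mem_left _ (C ((c⁻¹ : Kˣ) : K)) (Ideal.mem_map_of_mem (torusAct K h) hfP)
  rwa [hc, ← mul_assoc, ← C_mul, Units.inv_mul, C_1, one_mul] at h1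

theorem exists_torus_weights [IsAlgClosed K] (u v : Kˣ) :
    ∃ h : Kˣ × Kˣ, h.1 ^ 4 * h.2 ^ 2 = u ∧ h.1 ^ 6 * h.2 ^ 4 = v := by
  have hsq : ∀ c : Kˣ, ∃ d : Kˣ, d ^ 2 = c := fun c => by
    obtain ⟨d, hd⟩ := IsAlgClosed.exists_pow_nat_eq (c : K) (n := 2) (by norm_num)
    have hd0 : d ≠ 0 := by
      rintro rfl
      exact c.ne_zero (by rw [← hd]; simp)
    exact ⟨Units.mk0 d hd0, Units.ext hd⟩
  -- From u = s⁴t² and v = s⁶t⁴ one gets u²/v = s² and then t² = u/s⁴.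
  obtain ⟨s, hs⟩ := hsq (u ^ 2 / v)
  obtain ⟨t, ht⟩ := hsq (u / s ^ 4)
  refine ⟨(s, t), ?_, ?_⟩
  · simp [ht]
  · have e : (s, t).1 ^ 6 * (s, t).2 ^ 4 = s ^ 6 * (t ^ 2) ^ 2 := by rw [← pow_mul]
    have e' : s ^ 6 * (u / s ^ 4) ^ 2 = u ^ 2 / s ^ 2 := by
      rw [div_pow, ← pow_mul, mul_div_assoc', mul_comm, div_eq_div_iff_mul_eq_mul, mul_assoc,
        ← pow_add]
    rw [e, ht, e', hs, div_div_cancel]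

/-- Wherever Ω₁Ω₂ ≠ 0, some torus element rescales the values of Ω₁, Ω₂ to α, β, so the point is a
zero of a translate of P. An element f of the intersection hence satisfies f·Ω₁Ω₂ = 0. -/
theorem iInf_map_torusAct_eq_bot [CharZero K] [IsAlgClosed K] {α β : K} (hα : α ≠ 0) (hβ : β ≠ 0)
    {P : Ideal (A K)} (hP : P ≤ Ideal.span {Ω₁ K - C α, Ω₂ K - C β}) :
    ⨅ h, P.map (torusAct K h) = ⊥ := by
  have hΩ : Ω₁ K ≠ 0 ∧ Ω₂ K ≠ 0 := by
    obtain ⟨x, -, h1, h2⟩ := exists_eval_Ω K 1 1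
    constructor
    · intro h
      simp [h] at h1
    · intro h
      simp [h] at h2
  rw [eq_bot_iff]
  intro f hf
  rw [Ideal.mem_iInf] at hf
  have key : f * (Ω₁ K * Ω₂ K) = 0 := by
    refine MvPolynomial.funext fun x => ?_
    rw [map_mul, map_mul, map_zero]
    by_cases h1 : eval x (Ω₁ K) = 0
    · simp [h1]
    by_cases h2 : eval x (Ω₂ K) = 0
    · simp [h2]
    obtain ⟨h, hu, hv⟩ := exists_torus_weights K (Units.mk0 α hα / Units.mk0 _ h1)
      (Units.mk0 β hβ / Units.mk0 _ h2)
    have hle : P.map (torusAct K h) ≤ RingHom.ker (eval x) := by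
      refine (Ideal.map_mono hP).trans ?_
      rw [Ideal.map_span, Ideal.span_le]
      rintro _ ⟨_, rfl | rfl, rfl⟩
      · rw [SetLike.mem_coe, RingHom.mem_ker, map_sub, torusAct_Ω₁, torusAct_C, hu]
        simp [h1]
      · rw [SetLike.mem_coe, RingHom.mem_ker, map_sub, torusAct_Ω₂, torusAct_C, hv]
        simp [h2]
    have := hle (hf h)
    rw [RingHom.mem_ker] at this
    rw [this, zero_mul]
  exact (mul_eq_zero.mp key).resolve_right (mul_ne_zero hΩ.1 hΩ.2)

end Torus

/-! ### From plane primes to the stratum -/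

section Classification

variable {K : Type*} [Field K]

theorem eq_X_of_dvd_X (m : MonomialOrder (Fin 2)) {p : MvPolynomial (Fin 2) K} (hm : m.Monic p)
    (hp : Irreducible p) {i : Fin 2} (h : p ∣ X i) : p = X i := by
  obtain ⟨u, hu⟩ := (hp.associated_of_dvd (X_prime (R := K) (i := i)).irreducible h)
  obtain ⟨c, -, hc⟩ := isUnit_iff_eq_C_of_isReduced.mp u.isUnit
  rw [hc, mul_comm] at hu
  have h1 := congrArg m.leadingCoeff hu
  rw [m.leadingCoeff_mul, m.leadingCoeff_C, hm.leadingCoeff_eq_one, m.leadingCoeff_X,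
    mul_one] at h1
  rw [← hu, h1, C_1, one_mul]

theorem exists_monic_associated (m : MonomialOrder (Fin 2)) {p : MvPolynomial (Fin 2) K}
    (hp : p ≠ 0) : ∃ q, m.Monic q ∧ Associated p q := by
  have h : m.leadingCoeff p ≠ 0 := m.leadingCoeff_ne_zero_iff.mpr hp
  refine ⟨p * C (m.leadingCoeff p)⁻¹, ?_, ?_⟩
  · rw [MonomialOrder.Monic, m.leadingCoeff_mul, m.leadingCoeff_C, mul_inv_cancel₀ h]
  · exact associated_mul_unit_right _ _ ((IsUnit.mk0 _ (inv_ne_zero h)).map C)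

/-- If all zeros of p lay on the axes, the Nullstellensatz would give p ∣ Y₁Y₂, so the monic
irreducible p would be Y₁ or Y₂. -/
theorem exists_torus_zero [IsAlgClosed K] (m : MonomialOrder (Fin 2)) {p : MvPolynomial (Fin 2) K}
    (hp : p ∈ monicIrreducibles K m) : ∃ α β : K, α ≠ 0 ∧ β ≠ 0 ∧ eval ![α, β] p = 0 := by
  obtain ⟨hm, hirr, h0, h1⟩ := hp
  by_contra! H
  have hprime := (Ideal.span_singleton_prime hirr.ne_zero).mpr
    (UniqueFactorizationMonoid.irreducible_iff_prime.mp hirr)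
  have hmem : X 0 * X 1 ∈ Ideal.span {p} := by
    rw [← IsPrime.vanishingIdeal_zeroLocus (K := K) (Ideal.span {p}), mem_vanishingIdeal_iff]
    intro a ha
    have e : ![a 0, a 1] = a := by
      ext j
      fin_cases j <;> rfl
    have hpa : eval ![a 0, a 1] p = 0 := by
      rw [e]
      exact ha p (Ideal.mem_span_singleton_self p)
    rw [map_mul, aeval_X, aeval_X]
    by_contra hne
    exact H _ _ (left_ne_zero_of_mul hne) (right_ne_zero_of_mul hne) hpa
  rcases hprime.mem_or_mem hmem with h | h
  · exact h0 (eq_X_of_dvd_X m hm hirr (Ideal.mem_span_singleton.mp h))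
  · exact h1 (eq_X_of_dvd_X m hm hirr (Ideal.mem_span_singleton.mp h))

variable [CharZero K]

/-- The yᵢ are nonzero torus eigenvectors, so they lie outside the prime P and are regular modulo
it. -/
theorem eq_map_evalΩ_of_mem_stratum {P : Ideal (A K)}
    (hP : P ∈ (bracket K).stratum (torusAct K) ⊥)
    (hreg : YRegular K ((P.comap (evalΩ K)).map (evalΩ K))) :
    P = (P.comap (evalΩ K)).map (evalΩ K) := by
  refine le_antisymm (le_map_comap_evalΩ K hP.1.1 (fun i a h => ?_) hreg) Ideal.map_comap_le
  exact (hP.1.isPrime.mem_or_mem h).resolve_left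
    (notMem_of_homogeneous hP.2 (fun h => torusAct_y K h i) (prime_y K i).ne_zero)

variable [IsAlgClosed K]

theorem mem_stratum_of_map {I : Ideal (MvPolynomial (Fin 2) K)} [I.IsPrime]
    (hreg : YRegular K (I.map (evalΩ K))) {α β : K} (hα : α ≠ 0) (hβ : β ≠ 0)
    (hI : I ≤ Ideal.span {X 0 - C α, X 1 - C β}) :
    I.map (evalΩ K) ∈ (bracket K).stratum (torusAct K) ⊥ :=
  ⟨(bracket K).isPoissonPrime_of_isPrime (isPoissonIdeal_map_evalΩ K I)
    (isPrime_map_evalΩ K I hreg),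
    iInf_map_torusAct_eq_bot K hα hβ (map_evalΩ_span_pair K α β ▸ Ideal.map_mono hI)⟩

end Classification

end PoissonG2

open PoissonG2 in
theorem mainTheorem5 {K : Type*} [Field K] [CharZero K] [IsAlgClosed K]
    (m : MonomialOrder (Fin 2)) :
    (PoissonG2.bracket K).stratum (PoissonG2.torusAct K) ⊥ =
      {⊥}
      ∪ {I | ∃ P ∈ PoissonG2.monicIrreducibles K m, I = Ideal.span {PoissonG2.atΩ K P}}
      ∪ {I | ∃ α β : K, α ≠ 0 ∧ β ≠ 0 ∧
          I = Ideal.span {PoissonG2.Ω₁ K - MvPolynomial.C α,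
            PoissonG2.Ω₂ K - MvPolynomial.C β}} := by
  ext P
  constructor
  · intro hP
    set I := P.comap (evalΩ K) with hI
    have hprime : I.IsPrime := by
      have := hP.1.isPrime
      exact Ideal.IsPrime.comap _
    -- A point where Ω₁ = Ω₂ = 1 certifies that both are nonzero; being torus eigenvectors, they
    -- then avoid P.
    obtain ⟨x, -, hx1, hx2⟩ := exists_eval_Ω K 1 1
    have hΩ₁ : MvPolynomial.X 0 ∉ I := fun h => by
      refine notMem_of_homogeneous hP.2 (fun h => ⟨_, torusAct_Ω₁ K h⟩) ?_
        (by simpa [hI, evalΩ] using h)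
      intro h
      simp [h] at hx1
    have hΩ₂ : MvPolynomial.X 1 ∉ I := fun h => by
      refine notMem_of_homogeneous hP.2 (fun h => ⟨_, torusAct_Ω₂ K h⟩) ?_
        (by simpa [hI, evalΩ] using h)
      intro h
      simp [h] at hx2
    rcases isPrime_cases I with h | ⟨p, hp, h⟩ | ⟨α, β, h⟩
    · have e : I.map (evalΩ K) = ⊥ := by rw [h, Ideal.map_bot]
      exact Or.inl (Or.inl ((eq_map_evalΩ_of_mem_stratum hP (e ▸ yRegular_bot K)).trans e))
    · obtain ⟨q, hq, hpq⟩ := exists_monic_associated m hp.ne_zero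
      have h : I = Ideal.span {q} := h.trans (Ideal.span_singleton_eq_span_singleton.mpr hpq)
      have e : I.map (evalΩ K) = Ideal.span {evalΩ K q} := by
        rw [h, Ideal.map_span, Set.image_singleton]
      have hqI : q ∈ I := h ▸ Ideal.mem_span_singleton_self q
      refine Or.inl (Or.inr ⟨q, ⟨hq, hpq.irreducible hp, ?_, ?_⟩,
        (eq_map_evalΩ_of_mem_stratum hP (e ▸ yRegular_span_evalΩ K hq.ne_zero)).trans e⟩)
      · rintro rfl
        exact hΩ₁ hqI
      · rintro rfl
        exact hΩ₂ hqI
    · have hα : α ≠ 0 := by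
        rintro rfl
        exact hΩ₁ (h ▸ Ideal.subset_span (by simp))
      have hβ : β ≠ 0 := by
        rintro rfl
        exact hΩ₂ (h ▸ Ideal.subset_span (by simp))
      have e := (congrArg (Ideal.map (evalΩ K)) h).trans (map_evalΩ_span_pair K α β)
      exact Or.inr ⟨α, β, hα, hβ,
        (eq_map_evalΩ_of_mem_stratum hP (e ▸ yRegular_span_sub K hα hβ)).trans e⟩
  · rintro ((rfl | ⟨p, hp, rfl⟩) | ⟨α, β, hα, hβ, rfl⟩)
    · have h : (⊥ : Ideal (MvPolynomial (Fin 2) K)).IsPrime := Ideal.isPrime_bot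
      have h0 : (⊥ : Ideal (MvPolynomial (Fin 2) K)).map (evalΩ K) = ⊥ := Ideal.map_bot
      -- Any point of (K*)² is a zero of the zero ideal; (1, 1) is chosen.
      have := mem_stratum_of_map (h0 ▸ yRegular_bot K) one_ne_zero one_ne_zero bot_le
      rwa [h0] at this
    · obtain ⟨α, β, hα, hβ, h0⟩ := exists_torus_zero m hp
      have hprime := (Ideal.span_singleton_prime hp.2.1.ne_zero).mpr
        (UniqueFactorizationMonoid.irreducible_iff_prime.mp hp.2.1)
      have e : (Ideal.span {p}).map (evalΩ K) = Ideal.span {atΩ K p} := by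
        rw [Ideal.map_span, Set.image_singleton]
        rfl
      rw [← e]
      refine mem_stratum_of_map (e ▸ yRegular_span_evalΩ K hp.2.1.ne_zero) hα hβ ?_
      rw [Ideal.span_singleton_le_iff_mem]
      simpa [h0] using sub_C_eval_mem_span ![α, β] p
    · have := isPrime_span_pair α β
      rw [← map_evalΩ_span_pair]
      refine mem_stratum_of_map ?_ hα hβ le_rfl
      rw [map_evalΩ_span_pair]
      exact yRegular_span_sub K hα hβ
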